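/- Theorem. Let $\mathbb{B}=\mathbb{N}\cup\{{}^{\blacktriangleright}d : d\in\mathbb{N}\}$, where $\mathbb N=\{0,1,2,\ldots\}$. A natural number $k$ meets the specification $d\in\mathbb{N}$ if $k=d$, and meets the specification ${}^{\blacktriangleright}d$ if $k\ge d$. An $\ell$-type digraph is a tuple $G=(V,E_1,\ldots,E_\ell)$ where $V$ is a finite (possibly empty) set and $E_1,\ldots,E_\ell$ are pairwise disjoint irreflexive binary relations on $V$ such that $(u,v)\in E_1\cup\cdots\cup E_\ell$ implies $(v,u)\notin E_1\cup\cdots\cup E_\ell$. It is complete if for any two different vertices $u,v$, one of $(u,v)$, $(v,u)$ lies in $E_1\cup\cdots\cup E_\ell$. For $C,D\in\mathbb{B}^{\ell\times m}$, $G$ is a $(C,D)$-regular digraph of size $\bar N=(N_1,\ldots,N_m)\in\mathbb{N}^m$ if there is a partition $V=V_1\cup\cdots\cup V_m$ into pairwise disjoint, possibly empty, sets with $|V_j|=N_j$ for all $j$, such that for all $1\le i\le\ell$, $1\le j\le m$ and $v\in V_j$, the number of incoming $E_i$-edges of $v$ meets $C_{i,j}$ and the number of outgoing $E_i$-edges of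 $v$ meets $D_{i,j}$. A Presburger formula is a first-order formula over $0,1,+$ and equality, interpreted in $\mathbb{N}$ (the order $\le$ is definable from these). Then for every $\ell,m\in\mathbb N$ and every $C,D\in\mathbb{B}^{\ell\times m}$ there is a Presburger formula $\mathsf{COMP\text{-}REG}_{C,D}(X_1,\ldots,X_m)$ such that for every $\bar N\in\mathbb{N}^m$: there exists a complete $\ell$-type $(C,D)$-regular digraph of size $\bar N$ if and only if $\mathsf{COMP\text{-}REG}_{C,D}(\bar N)$ holds. -/

import Mathlib

/-- A degree specification, an element of `𝔹 = ℕ ∪ ▸ℕ`: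
either an exact degree `d`, or a lower bound `▸d`. -/
inductive DegreeSpec : Type
  | exactly (d : ℕ) : DegreeSpec
  | atLeast (d : ℕ) : DegreeSpec

/-- The number `k` meets the specification: `k = d`, respectively `k ≥ d`. -/
def DegreeSpec.Holds : DegreeSpec → ℕ → Prop
  | .exactly d, k => k = d
  | .atLeast d, k => d ≤ k

/-- An `ℓ`-type digraph on the vertex set `V`: pairwise disjoint irreflexive relations
`E 0, …, E (ℓ - 1)` such that no edge (of any type) has an edge (of any type) in the
inverse direction. -/
structure TypeDigraph (ℓ : ℕ) (V : Type*) where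
  E : Fin ℓ → V → V → Prop
  pairwise_disjoint : ∀ i j, i ≠ j → ∀ u v, ¬ (E i u v ∧ E j u v)
  irreflexive : ∀ i v, ¬ E i v v
  no_inverse : ∀ u v, (∃ i, E i u v) → ¬ ∃ j, E j v u

namespace TypeDigraph

variable {ℓ m : ℕ} {V : Type*}

/-- The number of incoming `E i`-edges of `v`. -/
noncomputable def inDeg (G : TypeDigraph ℓ V) (i : Fin ℓ) (v : V) : ℕ :=
  {u : V | G.E i u v}.ncard

/-- The number of outgoing `E i`-edges of `v`. -/
noncomputable def outDeg (G : TypeDigraph ℓ V) (i : Fin ℓ) (v : V) : ℕ :=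
  {w : V | G.E i v w}.ncard

/-- Any two different vertices are joined by an edge, in one direction or the other. -/
def IsComplete (G : TypeDigraph ℓ V) : Prop :=
  ∀ u v : V, u ≠ v → (∃ i, G.E i u v) ∨ (∃ i, G.E i v u)

/-- `P 0, …, P (m - 1)` is a witness of the `(C, D)`-regularity of `G`: it is a partition of the
vertex set into `m` labelled, possibly empty, parts, and for every vertex `v` in `P j` the number
of incoming `E i`-edges is as prescribed by `C i j` and that of outgoing ones by `D i j`. -/
structure IsRegularWitness (G : TypeDigraph ℓ V) (C D : Matrix (Fin ℓ) (Fin m) DegreeSpec)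
    (P : Fin m → Set V) : Prop where
  disjoint : Pairwise fun j k => Disjoint (P j) (P k)
  cover : ⋃ j, P j = Set.univ
  inDeg_holds : ∀ i j, ∀ v ∈ P j, (C i j).Holds (G.inDeg i v)
  outDeg_holds : ∀ i j, ∀ v ∈ P j, (D i j).Holds (G.outDeg i v)

/-- `G` is a `(C, D)`-regular digraph of size `N = (N 0, …, N (m - 1))`. -/
def IsRegularOfSize (G : TypeDigraph ℓ V) (C D : Matrix (Fin ℓ) (Fin m) DegreeSpec)
    (N : Fin m → ℕ) : Prop :=
  ∃ P : Fin m → Set V, G.IsRegularWitness C D P ∧ ∀ j, (P j).ncard = N j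

end TypeDigraph

/-- There is a (finite) `(C, D)`-complete-regular digraph of size `N`. -/
def ExistsCompleteRegularDigraph {ℓ m : ℕ} (C D : Matrix (Fin ℓ) (Fin m) DegreeSpec)
    (N : Fin m → ℕ) : Prop :=
  ∃ (V : Type) (_ : Finite V) (G : TypeDigraph ℓ V), G.IsComplete ∧ G.IsRegularOfSize C D N

/-- The way in which an edge is seen from one of its two ends: a colour, together with `true` if
the edge is outgoing and `false` if it is incoming. -/
abbrev HalfEdge (ℓ : ℕ) := Fin ℓ × Bool

namespace HalfEdge

variable {ℓ : ℕ}

/-- The same edge, seen from the other end. -/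
def bar (t : HalfEdge ℓ) : HalfEdge ℓ := (t.1, !t.2)

@[simp] lemma bar_bar (t : HalfEdge ℓ) : t.bar.bar = t := by simp [bar]

lemma ne_bar (t : HalfEdge ℓ) : t ≠ t.bar := by simp [bar, Prod.ext_iff]

lemma bar_inj {s t : HalfEdge ℓ} : s.bar = t.bar ↔ s = t :=
  ⟨fun h => by simpa using congrArg bar h, fun h => h ▸ rfl⟩

end HalfEdge

lemma sum_sum_lt_sum_sum {α β : Type*} [Fintype α] [Fintype β] {M : Type*} [AddCommMonoid M]
    [PartialOrder M] [IsOrderedCancelAddMonoid M] {f g : α → β → M} (h : ∀ a b, f a b ≤ g a b)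
    (a : α) (b : β) (hab : f a b < g a b) : ∑ a, ∑ b, f a b < ∑ a, ∑ b, g a b :=
  Finset.sum_lt_sum (fun a _ => Finset.sum_le_sum fun b _ => h a b)
    ⟨a, Finset.mem_univ _, Finset.sum_lt_sum (fun b _ => h a b) ⟨b, Finset.mem_univ _, hab⟩⟩

lemma sum_sum_ite_and_eq {α β : Type*} [Fintype α] [Fintype β] [DecidableEq α]
    [DecidableEq β] (a : α) (b : β) :
    ∑ x : α, ∑ y : β, (if x = a ∧ y = b then 1 else 0) = 1 := by
  simp [ite_and]

/-! ### Partial colourings, their degrees and local changes -/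

/-- A digraph with coloured edges, not necessarily complete: `col u v` is the edge between `u` and
`v` as seen from `u`. -/
@[ext]
structure PartialColoring (ℓ : ℕ) (V : Type*) where
  col : V → V → Option (HalfEdge ℓ)
  col_self : ∀ v, col v v = none
  col_symm : ∀ u v, col v u = (col u v).map HalfEdge.bar

namespace PartialColoring

open Finset HalfEdge

variable {ℓ : ℕ} {V : Type*}

instance [Finite V] : Finite (PartialColoring ℓ V) :=
  Finite.of_injective col fun _ _ => PartialColoring.ext

/-- A fixed finite vertex set carries finitely many colourings, so extremal choices are available;
the switching arguments all start from one. -/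
lemma exists_maximal [Finite V] {M : Type*} [LinearOrder M] (p : PartialColoring ℓ V → Prop)
    (f : PartialColoring ℓ V → M) (h : ∃ P, p P) : ∃ P, p P ∧ ∀ Q, p Q → f Q ≤ f P :=
  Set.exists_max_image {P | p P} f (Set.toFinite _) h

variable (P : PartialColoring ℓ V)

lemma col_eq_some_comm {u v : V} {t : HalfEdge ℓ} :
    P.col u v = some t ↔ P.col v u = some t.bar := by
  rw [P.col_symm u v]
  cases P.col u v <;> simp [bar_inj]

lemma col_eq_none_comm {u v : V} : P.col u v = none ↔ P.col v u = none := by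
  rw [P.col_symm u v]; simp

lemma ne_of_col_eq_some {u v : V} {t : HalfEdge ℓ} (h : P.col u v = some t) : u ≠ v := by
  rintro rfl; simp [P.col_self] at h

/-- Replace the edge, if any, between `a` and `b`. -/
def update [DecidableEq V] {a b : V} (h : a ≠ b) (o : Option (HalfEdge ℓ)) :
    PartialColoring ℓ V where
  col u v := if u = a ∧ v = b then o else if u = b ∧ v = a then o.map bar else P.col u v
  col_self v := by
    have : ¬ (v = a ∧ v = b) := fun hv => h (hv.1.symm.trans hv.2)
    have : ¬ (v = b ∧ v = a) := fun hv => h (hv.2.symm.trans hv.1)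
    simp [*, P.col_self]
  col_symm u v := by
    have := P.col_symm u v
    have : (bar ∘ bar : HalfEdge ℓ → HalfEdge ℓ) = id := by ext t : 1; simp
    by_cases h1 : u = a ∧ v = b
    · obtain ⟨rfl, rfl⟩ := h1; simp [h, h.symm]
    · by_cases h2 : u = b ∧ v = a
      · obtain ⟨rfl, rfl⟩ := h2; simp [h, h.symm, this]
      · rw [if_neg (by tauto), if_neg (by tauto), if_neg h1, if_neg h2]; assumption

section Update

variable [DecidableEq V] {a b : V} (h : a ≠ b)

@[simp] lemma col_update_self (o : Option (HalfEdge ℓ)) : (P.update h o).col a b = o := by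
  simp [update]

lemma col_update_of_ne (o : Option (HalfEdge ℓ)) {u v : V} (h1 : ¬ (u = a ∧ v = b))
    (h2 : ¬ (u = b ∧ v = a)) : (P.update h o).col u v = P.col u v := by
  simp only [update]; rw [if_neg h1, if_neg h2]

lemma update_none_of_update (o : Option (HalfEdge ℓ)) (hab : P.col a b = none) :
    (P.update h o).update h none = P := by
  ext u v : 3
  have hba := P.col_eq_none_comm.1 hab
  simp only [update]
  split_ifs with h1 h2
  · rw [h1.1, h1.2, hab]
  · rw [h2.1, h2.2, hba]; rfl
  · rfl

end Update

variable [Fintype V]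

/-- The number of edges at `v` which look like `t` from `v`. -/
def deg (v : V) (t : HalfEdge ℓ) : ℕ := #{u | P.col v u = some t}

/-- Double counting: each edge that is `t` from one end is `t.bar` from the other. -/
lemma sum_deg_bar (t : HalfEdge ℓ) : ∑ v, P.deg v t.bar = ∑ v, P.deg v t := by
  simp only [deg, card_filter]
  rw [sum_comm]
  refine sum_congr rfl fun u _ => sum_congr rfl fun v _ => ?_
  exact if_congr (by rw [P.col_eq_some_comm, bar_bar]) rfl rfl

/-- The vertices joined to `v`. -/
def nbrs (v : V) : Finset V := {u | P.col v u ≠ none}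

@[simp] lemma mem_nbrs {u v : V} : u ∈ P.nbrs v ↔ P.col v u ≠ none := by simp [nbrs]

lemma card_nbrs (v : V) : #(P.nbrs v) = ∑ t, P.deg v t := by
  classical
  rw [card_eq_sum_card_fiberwise (f := P.col v) (t := univ) (by simp), Fintype.sum_option]
  simp only [nbrs, deg, filter_filter]
  rw [filter_false_of_mem (by simp)]
  simp only [card_empty, zero_add]
  refine sum_congr rfl fun t _ => congrArg card (filter_congr fun u _ => ?_)
  constructor <;> simp +contextual

lemma card_nbrs_le {B : ℕ} {v : V} (h : ∀ t, P.deg v t ≤ B) :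
    #(P.nbrs v) ≤ Fintype.card (HalfEdge ℓ) * B := by
  rw [card_nbrs, ← smul_eq_mul, Fintype.card, ← sum_const]
  exact sum_le_sum fun t _ => h t

lemma exists_of_deg_pos {v : V} {t : HalfEdge ℓ} (h : 0 < P.deg v t) :
    ∃ u, P.col v u = some t := by
  obtain ⟨u, hu⟩ := card_pos.1 h
  exact ⟨u, by simpa using hu⟩

section Update

variable [DecidableEq V] {a b : V} (h : a ≠ b)

/-- The lost half-edges are added on the left to avoid truncated subtraction, so that degree changes
can be handled by linear arithmetic. -/
lemma deg_update_none {t : HalfEdge ℓ} (hab : P.col a b = some t) (v : V) (s : HalfEdge ℓ) :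
    (P.update h none).deg v s + (if v = a ∧ s = t then 1 else 0)
      + (if v = b ∧ s = t.bar then 1 else 0) = P.deg v s := by
  have hba := P.col_eq_some_comm.1 hab
  simp only [deg, card_filter]
  by_cases hva : v = a
  · subst hva
    rw [← add_sum_erase _ _ (mem_univ b), ← add_sum_erase (a := b) (s := univ)
      (f := fun u => if P.col v u = some s then 1 else 0) (mem_univ b), sum_congr rfl
      (g := fun u => if P.col v u = some s then 1 else 0) fun u hu => by
        rw [col_update_of_ne] <;> simp_all]
    simp [h, hab, eq_comm (a := t)]
    omega
  · by_cases hvb : v = b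
    · subst hvb
      rw [← add_sum_erase _ _ (mem_univ a), ← add_sum_erase (a := a) (s := univ)
        (f := fun u => if P.col v u = some s then 1 else 0) (mem_univ a), sum_congr rfl
        (g := fun u => if P.col v u = some s then 1 else 0) fun u hu => by
          rw [col_update_of_ne] <;> simp_all]
      rw [col_symm _ a v, col_update_self]
      simp [h.symm, hba, eq_comm (a := t.bar)]
      omega
    · simp only [hva, hvb, false_and, if_false, add_zero]
      exact sum_congr rfl fun u _ => by rw [col_update_of_ne] <;> simp [hva, hvb]

lemma deg_update_some (t : HalfEdge ℓ) (hab : P.col a b = none) (v : V) (s : HalfEdge ℓ) :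
    (P.update h (some t)).deg v s = P.deg v s + (if v = a ∧ s = t then 1 else 0)
      + (if v = b ∧ s = t.bar then 1 else 0) := by
  rw [← deg_update_none (P.update h (some t)) h (col_update_self ..),
    P.update_none_of_update h _ hab]

end Update

/-- If every edge between two big sets is one of few edges of its kind at one of its ends, then
some edge is missing. -/
lemma exists_forall_lt_deg {B : ℕ} (X Y : Finset V)
    (hX : 2 * (Fintype.card (HalfEdge ℓ) * B) < #X)
    (hY : 4 * (Fintype.card (HalfEdge ℓ) * B) + 1 < #Y) :
    ∃ x ∈ X, ∃ y ∈ Y, x ≠ y ∧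
      ∀ t, P.col x y = some t → B < P.deg x t ∧ B < P.deg y t.bar := by
  classical
  set D := Fintype.card (HalfEdge ℓ) * B with hD
  by_contra! hcon
  -- Disjoint sets of size `2 * D + 1` suffice: each vertex has at most `D` edges of kinds that are
  -- scarce at it, so at most `2 * D * (2 * D + 1)` of the `(2 * D + 1) ^ 2` pairs are accounted
  -- for.
  obtain ⟨X', hX', hX'c⟩ := exists_subset_card_eq (Nat.succ_le_of_lt hX)
  have hY'c : 2 * D + 1 ≤ #(Y \ X') := by
    have := le_card_sdiff X' Y
    omega
  obtain ⟨Y', hY', hY'c⟩ := exists_subset_card_eq hY'c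
  let F : V → Finset V := fun v => {u | ∃ t, P.col v u = some t ∧ P.deg v t ≤ B}
  have hF : ∀ v, #(F v) ≤ D := fun v => by
    have : F v ⊆ ({t | P.deg v t ≤ B} : Finset (HalfEdge ℓ)).biUnion
        fun t => {u | P.col v u = some t} := fun u => by
      simp only [F, mem_filter, mem_univ, true_and, mem_biUnion]
      tauto
    refine (card_le_card this).trans (card_biUnion_le.trans ?_)
    refine (sum_le_card_nsmul _ _ B fun t ht => (mem_filter.1 ht).2).trans ?_
    exact Nat.mul_le_mul_right _ (card_le_univ _)
  have hsub : X' ×ˢ Y' ⊆ (X'.sigma F).map (Equiv.sigmaEquivProd V V).toEmbedding ∪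
      (Y'.sigma F).map ((Equiv.sigmaEquivProd V V).trans (Equiv.prodComm V V)).toEmbedding := by
    rintro ⟨x, y⟩ hxy
    rw [mem_product] at hxy
    have hyY := mem_sdiff.1 (hY' hxy.2)
    obtain ⟨t, ht, h⟩ := hcon x (hX' hxy.1) y hyY.1 (fun e => hyY.2 (e ▸ hxy.1))
    rw [mem_union]
    by_cases hB : P.deg x t ≤ B
    · left
      rw [mem_map]
      exact ⟨⟨x, y⟩, mem_sigma.2 ⟨hxy.1, mem_filter.2 ⟨mem_univ _, t, ht, hB⟩⟩, rfl⟩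
    · right
      rw [mem_map]
      exact ⟨⟨y, x⟩, mem_sigma.2 ⟨hxy.2, mem_filter.2 ⟨mem_univ _, t.bar,
        P.col_eq_some_comm.1 ht, h (not_le.1 hB)⟩⟩, rfl⟩
  have := (card_le_card hsub).trans (card_union_le _ _)
  rw [card_product, card_map, card_map, card_sigma, card_sigma, hX'c, hY'c] at this
  have h1 := sum_le_card_nsmul X' _ D fun v _ => hF v
  have h2 := sum_le_card_nsmul Y' _ D fun v _ => hF v
  rw [hX'c] at h1
  rw [hY'c] at h2
  simp only [smul_eq_mul, Nat.succ_eq_add_one] at *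
  nlinarith

end PartialColoring

/-! ### Switching arguments -/

namespace PartialColoring

open Finset HalfEdge

variable {ℓ : ℕ} {V : Type*} [Fintype V] [DecidableEq V] (P : PartialColoring ℓ V)

/-- The move by which a maximal partial colouring is seen to exhaust the demand on one side. -/
lemma exists_deg_succ {D : ℕ} (hD : ∀ v, #(P.nbrs v) ≤ D) {t : HalfEdge ℓ} {u w : V}
    {d : V → HalfEdge ℓ → ℕ} (hw : P.deg w t.bar < d w t.bar)
    (hcard : (D + 1) ^ 2 < #{v | d v t.bar ≠ 0}) :
    ∃ (Q : PartialColoring ℓ V) (z : V), P.deg z t.bar < d z t.bar ∧ ∀ v s,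
      Q.deg v s = P.deg v s + (if v = u ∧ s = t then 1 else 0)
        + (if v = z ∧ s = t.bar then 1 else 0) := by
  let N : V → Finset V := fun v => insert v (P.nbrs v)
  have hN : ∀ v, #(N v) ≤ D + 1 := fun v =>
    (card_insert_le _ _).trans (Nat.succ_le_succ (hD v))
  have hbad : #(N u ∪ (N w).biUnion P.nbrs) ≤ (D + 1) ^ 2 := by
    have h1 := card_biUnion_le_card_mul (N w) P.nbrs D fun v _ => hD v
    have h2 := Nat.mul_le_mul_right D (hN w)
    have h3 := card_union_le (N u) ((N w).biUnion P.nbrs)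
    have := hN u
    nlinarith
  -- `b` is taken outside the closed neighbourhood of `u` and is joined neither to `w` nor to a
  -- neighbour of `w`.
  obtain ⟨b, hb, hbN⟩ := exists_mem_notMem_of_card_lt_card (hbad.trans_lt hcard)
  simp only [mem_filter, mem_univ, true_and, mem_union, mem_biUnion, N, mem_insert, mem_nbrs,
    not_or, not_exists, not_and, not_not] at hb hbN
  obtain ⟨⟨hbu, hub⟩, hbw⟩ := hbN
  by_cases hlt : P.deg b t.bar < d b t.bar
  · exact ⟨P.update (Ne.symm hbu) (some t), b, hlt, P.deg_update_some _ t hub⟩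
  -- Now `b` is saturated, so it has an edge from some `a`. Replacing `ab` by `ub` and `aw` keeps
  -- the degrees of `a` and `b` and serves `u` and `w`; the choice of `b` makes both new places
  -- free.
  obtain ⟨a, ha⟩ := P.exists_of_deg_pos (v := b) (t := t.bar) (by omega)
  have hab : P.col a b = some t := P.col_eq_some_comm.2 ha
  have haw : a ≠ w := fun h => by simpa [hab] using hbw a (Or.inl h)
  have hwa : P.col w a = none := by
    by_contra h
    simpa [hab] using hbw a (Or.inr h)
  have hau : a ≠ u := fun h => by simp [← h, hab] at hub
  have hbw' : b ≠ w := fun h => hlt (h ▸ hw)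
  have hne := P.ne_of_col_eq_some hab
  let P₁ := P.update hne none
  have h1 : P₁.col u b = none := by
    rw [col_update_of_ne] <;> [exact hub; tauto; tauto]
  let P₂ := P₁.update (Ne.symm hbu) (some t)
  have h2 : P₂.col a w = none := by
    rw [col_update_of_ne, col_update_of_ne] <;>
      [exact P.col_eq_none_comm.1 hwa; tauto; tauto; tauto; tauto]
  refine ⟨P₂.update haw (some t), w, hw, fun v s => ?_⟩
  have e1 := P.deg_update_none hne hab v s
  rw [deg_update_some _ _ _ h2, deg_update_some _ _ _ h1]
  change P₁.deg v s + _ + _ = _ at e1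
  omega

/-- Given demands that agree on the side where only exact degrees are present, there is a partial
colouring which exceeds no demand and meets all those that cannot be met from one side only. -/
lemma exists_deg_le {B K : ℕ} {d : V → HalfEdge ℓ → ℕ} (hd : ∀ v t, d v t ≤ B)
    (hK : (Fintype.card (HalfEdge ℓ) * B + 1) ^ 2 ≤ K) (strict : HalfEdge ℓ → Prop)
    (hzone : ∀ t, strict t → (∀ v, d v t.bar = 0) ∨ K < #{v | d v t.bar ≠ 0})
    (hsum : ∀ t, strict t → ∑ v, d v t ≤ ∑ v, d v t.bar) :
    ∃ P : PartialColoring ℓ V, (∀ v t, P.deg v t ≤ d v t) ∧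
      ∀ t, strict t → ∀ v, P.deg v t = d v t := by
  obtain ⟨P, hP, hmax⟩ := exists_maximal
    (fun P : PartialColoring ℓ V => ∀ v t, P.deg v t ≤ d v t) (fun P => ∑ v, ∑ t, P.deg v t)
    ⟨⟨fun _ _ => none, fun _ => rfl, fun _ _ => rfl⟩, fun v t => by simp [deg]⟩
  refine ⟨P, hP, fun t ht u => (hP u t).antisymm (not_lt.1 fun hu => ?_)⟩
  by_cases hw : ∃ w, P.deg w t.bar < d w t.bar
  · obtain ⟨w, hw⟩ := hw
    have hcard : K < #{v | d v t.bar ≠ 0} :=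
      (hzone t ht).resolve_left fun h => by simp [h] at hw
    obtain ⟨Q, z, hz, hQ⟩ := P.exists_deg_succ (u := u)
      (fun v => P.card_nbrs_le fun t => (hP v t).trans (hd v t)) hw (hK.trans_lt hcard)
    refine (hmax Q fun v s => ?_).not_gt (sum_sum_lt_sum_sum (fun v s => ?_) u t ?_)
    · have := hP v s
      have := t.ne_bar
      rw [hQ]
      by_cases h1 : v = u ∧ s = t
      · obtain ⟨rfl, rfl⟩ := h1
        simp [this]
        omega
      · by_cases h2 : v = z ∧ s = t.bar
        · obtain ⟨rfl, rfl⟩ := h2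
          rw [if_neg h1, if_pos ⟨rfl, rfl⟩]
          omega
        · rw [if_neg h1, if_neg h2]
          omega
    · rw [hQ]; omega
    · rw [hQ, if_pos ⟨rfl, rfl⟩]; omega
  -- No vertex lacks `t.bar`, so double counting contradicts `hsum`.
  · push Not at hw
    have h1 : ∑ v, P.deg v t < ∑ v, d v t :=
      sum_lt_sum (fun v _ => hP v t) ⟨u, mem_univ _, hu⟩
    have h2 : ∑ v, d v t.bar ≤ ∑ v, P.deg v t.bar := sum_le_sum fun v _ => hw v
    have := hsum t ht
    rw [P.sum_deg_bar] at h2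
    omega

/-- A partial colouring that meets all demands at the sides where no lower bound is present on the
other end can be modified to meet all demands. -/
lemma exists_le_deg {B K : ℕ} {lo : V → HalfEdge ℓ → Prop} {d : V → HalfEdge ℓ → ℕ}
    (hd : ∀ v t, d v t ≤ B)
    (hK : (Fintype.card (HalfEdge ℓ) + 1) * (4 * (Fintype.card (HalfEdge ℓ) * B) + B + 2) ≤ K)
    (hlo : ∀ t, (∃ v, lo v t) → ∃ X : Finset V, (∀ v ∈ X, lo v t) ∧ K < #X)
    (h : ∃ P : PartialColoring ℓ V, (∀ v t, ¬ lo v t → P.deg v t ≤ d v t) ∧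
      ∀ t, (∀ v, ¬ lo v t.bar) → ∀ v, d v t ≤ P.deg v t) :
    ∃ P : PartialColoring ℓ V, (∀ v t, ¬ lo v t → P.deg v t ≤ d v t) ∧
      ∀ v t, d v t ≤ P.deg v t := by
  -- Satisfied demand is maximised first, superfluous edges are penalised second. The weight 4
  -- outweighs the increase by 2 of the degree sum in each improving move below.
  obtain ⟨P, ⟨hP, hP'⟩, hmax⟩ := exists_maximal _ (fun P : PartialColoring ℓ V =>
    4 * ((∑ v, ∑ t, min (P.deg v t) (d v t) : ℕ) : ℤ) - (∑ v, ∑ t, P.deg v t : ℕ)) h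
  refine ⟨P, hP, ?_⟩
  -- every edge is needed at one of its ends
  have hneed : ∀ a b t, P.col a b = some t → d a t < P.deg a t → P.deg b t.bar ≤ d b t.bar := by
    intro a b t hab ha
    by_contra! hb
    have hne := P.ne_of_col_eq_some hab
    have hQ := P.deg_update_none hne hab
    set Q := P.update hne none
    have hle : ∀ v s, Q.deg v s ≤ P.deg v s := fun v s => by have := hQ v s; omega
    have hge : ∀ v s, Q.deg v s < P.deg v s → d v s ≤ Q.deg v s := fun v s hlt => by
      have := hQ v s
      by_cases h1 : v = a ∧ s = t
      · obtain ⟨rfl, rfl⟩ := h1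
        rw [if_neg (c := v = b ∧ _) fun h => s.ne_bar h.2] at this
        simp at this; omega
      · by_cases h2 : v = b ∧ s = t.bar
        · obtain ⟨rfl, rfl⟩ := h2
          rw [if_neg h1] at this
          simp at this; omega
        · rw [if_neg h1, if_neg h2] at this; omega
    have h1 : ∑ v, ∑ s, min (P.deg v s) (d v s) ≤ ∑ v, ∑ s, min (Q.deg v s) (d v s) :=
      sum_le_sum fun v _ => sum_le_sum fun s _ => by
        have := hge v s
        rcases (hle v s).lt_or_eq with h | h <;> omega
    have h2 := sum_sum_lt_sum_sum hle a t (by have := hQ a t; simp at this; omega)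
    refine (hmax Q ⟨fun v s hs => (hle v s).trans (hP v s hs), fun s hs v => ?_⟩).not_gt
      (by omega)
    have := hP' s hs v
    rcases (hle v s).lt_or_eq with h | h
    · exact hge v s h
    · omega
  by_contra! hcon
  obtain ⟨u, t, hut⟩ := hcon
  have hex : ∃ v, lo v t.bar := by
    by_contra! h
    exact (hP' t h u).not_gt hut
  obtain ⟨X, hX, hXK⟩ := hlo _ hex
  by_cases hadj : ∃ w ∈ X, u ≠ w ∧ P.col u w = none
  · obtain ⟨w, hw, huw, hnone⟩ := hadj
    have hQ := P.deg_update_some huw t hnone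
    set Q := P.update huw (some t)
    have h1 : ∑ v, ∑ s, min (P.deg v s) (d v s) < ∑ v, ∑ s, min (Q.deg v s) (d v s) :=
      sum_sum_lt_sum_sum (fun v s => by have := hQ v s; omega) u t
        (by have := hQ u t; simp at this; omega)
    have h2 : ∑ v, ∑ s, Q.deg v s = ∑ v, ∑ s, P.deg v s + 1 + 1 := by
      simp only [hQ, sum_add_distrib, sum_sum_ite_and_eq]
    refine (hmax Q ⟨fun v s hs => ?_, fun s hs v => ?_⟩).not_gt (by omega)
    · have := hP v s hs
      rw [hQ]
      rw [if_neg (c := v = w ∧ _) fun h => hs (by rw [h.1, h.2]; exact hX w hw)]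
      split_ifs with h
      · obtain ⟨rfl, rfl⟩ := h; omega
      · omega
    · have := hP' s hs v
      have := hQ v s
      omega
  · push Not at hadj
    -- As `u` is joined to all other vertices of `X`, one colour `s` occurs very often. The
    -- threshold exceeds `B`, which forces a lower bound at `u` for `s`, and is large enough for
    -- `exists_forall_lt_deg`.
    obtain ⟨o, -, ho⟩ := exists_lt_card_fiber_of_mul_lt_card_of_maps_to (s := X.erase u)
      (t := univ) (f := P.col u) (n := 4 * (Fintype.card (HalfEdge ℓ) * B) + B + 1)
      (fun _ _ => mem_univ _) (by
        have := pred_card_le_card_erase (s := X) (a := u)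
        rw [card_univ, Fintype.card_option]
        have : (Fintype.card (HalfEdge ℓ) + 1) * (4 * (Fintype.card (HalfEdge ℓ) * B) + B + 2) =
          (Fintype.card (HalfEdge ℓ) + 1) * (4 * (Fintype.card (HalfEdge ℓ) * B) + B + 1) +
            (Fintype.card (HalfEdge ℓ) + 1) := by ring
        omega)
    obtain ⟨w₀, hw₀⟩ := card_pos.1 (Nat.zero_lt_of_lt ho)
    rw [mem_filter, mem_erase] at hw₀
    obtain ⟨s, rfl⟩ : ∃ s, o = some s := Option.ne_none_iff_exists'.1
      (hw₀.2 ▸ hadj w₀ hw₀.1.2 (Ne.symm hw₀.1.1))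
    have hus : B < P.deg u s := by
      refine lt_of_lt_of_le ?_ (card_le_card (filter_subset_filter _ (subset_univ (X.erase u))))
      omega
    have hlous : lo u s := by
      by_contra h
      have := hP u s h
      have := hd u s
      omega
    obtain ⟨Y, hY, hYK⟩ := hlo s ⟨u, hlous⟩
    obtain ⟨y, hy, w, hw, hyw, hne⟩ := P.exists_forall_lt_deg (B := B) Y _ (by nlinarith)
      (lt_of_le_of_lt (by omega) ho)
    rw [mem_filter, mem_erase] at hw
    -- An edge here would be in surplus at both ends, against `hneed`.
    have hnone : P.col y w = none := by
      by_contra h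
      obtain ⟨r, hr⟩ := Option.ne_none_iff_exists'.1 h
      have h1 := hne r hr
      have h2 := hneed y w r hr ((hd y r).trans_lt h1.1)
      have := hd w r.bar
      omega
    have huw : u ≠ w := Ne.symm hw.1.1
    have hyu : y ≠ u := by
      rintro rfl; simp [hnone] at hw
    -- Recolour `uw` from `s` to `t` and add `yw` with colour `s`. The loss of `s.bar` at `w` is
    -- made good by `y`; `u` has a surplus of `s`; the additional half-edges at `w` and `y` fall
    -- under lower bounds.
    let P₁ := P.update huw none
    let P₂ := P₁.update huw (some t)
    have h2 : P₂.col y w = none := by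
      rw [col_update_of_ne, col_update_of_ne] <;> [exact hnone; tauto; tauto; tauto; tauto]
    have hQ : ∀ v r, (P₂.update hyw (some s)).deg v r + (if v = u ∧ r = s then 1 else 0) =
        P.deg v r + (if v = y ∧ r = s then 1 else 0) + (if v = u ∧ r = t then 1 else 0)
          + (if v = w ∧ r = t.bar then 1 else 0) := fun v r => by
      have e1 := P.deg_update_none huw hw.2 v r
      rw [deg_update_some _ _ _ h2, deg_update_some _ _ _ (col_update_self ..)]
      omega
    set Q := P₂.update hyw (some s)
    have hdus := hd u s
    have hge : ∀ v r, d v r ≤ P.deg v r → d v r ≤ Q.deg v r := fun v r h => by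
      have := hQ v r
      split_ifs at this with h1 <;> try omega
      all_goals obtain ⟨rfl, rfl⟩ := h1
      all_goals omega
    have hst : s ≠ t := by
      rintro rfl; omega
    have h1 : ∑ v, ∑ r, min (P.deg v r) (d v r) < ∑ v, ∑ r, min (Q.deg v r) (d v r) := by
      refine sum_sum_lt_sum_sum (fun v r => ?_) u t ?_
      · have := hge v r
        have := hQ v r
        by_cases h1 : v = u ∧ r = s
        · obtain ⟨rfl, rfl⟩ := h1
          omega
        · rw [if_neg h1] at this
          omega
      · have := hQ u t
        simp [hst.symm] at this
        omega
    have h2 : ∑ v, ∑ r, Q.deg v r + 1 = ∑ v, ∑ r, P.deg v r + 1 + 1 + 1 := by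
      have : ∑ v, ∑ r, (Q.deg v r + (if v = u ∧ r = s then 1 else 0)) = _ :=
        sum_congr rfl fun v _ => sum_congr rfl fun r _ => hQ v r
      simpa only [sum_add_distrib, sum_sum_ite_and_eq] using this
    refine (hmax Q ⟨fun v r hr => ?_, fun r hr v => hge v r (hP' r hr v)⟩).not_gt (by omega)
    have e := hQ v r
    have := hP v r hr
    rw [if_neg (c := v = w ∧ _) fun h => hr (by rw [h.1, h.2]; exact hX w hw.1.2),
      if_neg (c := v = y ∧ _) fun h => hr (by rw [h.1, h.2]; exact hY y hy),
      if_neg (c := v = u ∧ r = s) fun h => hr (by rw [h.1, h.2]; exact hlous)] at e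
    split_ifs at e with h
    · obtain ⟨rfl, rfl⟩ := h; omega
    · omega

/-- Missing edges can be added when they are permitted at both ends. -/
lemma exists_complete {lo : V → HalfEdge ℓ → Prop} {d : V → HalfEdge ℓ → ℕ}
    (hcompat : ∀ u v, u ≠ v → ∃ t, lo u t ∧ lo v t.bar)
    (h : ∃ P : PartialColoring ℓ V, (∀ v t, ¬ lo v t → P.deg v t ≤ d v t) ∧
      ∀ v t, d v t ≤ P.deg v t) :
    ∃ P : PartialColoring ℓ V, (∀ u v, u ≠ v → P.col u v ≠ none) ∧
      (∀ v t, ¬ lo v t → P.deg v t ≤ d v t) ∧ ∀ v t, d v t ≤ P.deg v t := by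
  obtain ⟨P, ⟨hP, hP'⟩, hmax⟩ := exists_maximal _ (fun P : PartialColoring ℓ V =>
    ∑ v, ∑ t, P.deg v t) h
  refine ⟨P, fun u v huv hnone => ?_, hP, hP'⟩
  obtain ⟨t, hu, hv⟩ := hcompat u v huv
  have hQ := P.deg_update_some huv t hnone
  refine (hmax (P.update huv (some t)) ⟨fun w s hs => ?_, fun w s => ?_⟩).not_gt
    (sum_sum_lt_sum_sum (fun w s => ?_) u t ?_)
  · rw [hQ, if_neg fun h => hs (by rw [h.1, h.2]; exact hu),
      if_neg fun h => hs (by rw [h.1, h.2]; exact hv)]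
    exact hP w s hs
  · have := hP' w s
    rw [hQ]; omega
  · rw [hQ]; omega
  · rw [hQ, if_pos ⟨rfl, rfl⟩]; omega

end PartialColoring

/-! ### Profiles, zones and the criterion for big zones -/

open Finset HalfEdge

/-- Degree specifications with bounds at most `B`, for each kind of half-edge: the flag tells whether
the number is a lower bound (`true`) or the exact degree (`false`). -/
abbrev Profile (ℓ B : ℕ) := HalfEdge ℓ → Bool × Fin (B + 1)

/-- The degree `k` is as prescribed by `p`. -/
def Meets {B : ℕ} (p : Bool × Fin (B + 1)) (k : ℕ) : Prop :=
  (p.2 : ℕ) ≤ k ∧ (p.1 = false → k ≤ p.2)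

variable {ℓ B : ℕ}

/-- The vertices can be joined to a complete coloured digraph with prescribed degrees. -/
def Realizable {V : Type*} [Fintype V] (τ : V → Profile ℓ B) : Prop :=
  ∃ P : PartialColoring ℓ V, (∀ u v, u ≠ v → P.col u v ≠ none) ∧
    ∀ v t, Meets (τ v t) (P.deg v t)

/-- There is a complete coloured digraph with `N p` vertices of profile `p`. -/
def RealizableSize (N : Profile ℓ B → ℕ) : Prop :=
  Realizable fun v : Σ p, Fin (N p) => v.1

lemma Realizable.comp_equiv {V W : Type*} [Fintype V] [Fintype W] {τ : V → Profile ℓ B}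
    (h : Realizable τ) (e : W ≃ V) : Realizable (τ ∘ e) := by
  obtain ⟨P, hP, hd⟩ := h
  refine ⟨⟨fun u v => P.col (e u) (e v), fun v => P.col_self _, fun u v => P.col_symm _ _⟩,
    fun u v huv => hP _ _ (e.injective.ne huv), fun v t => ?_⟩
  rw [show PartialColoring.deg _ v t = P.deg (e v) t from card_equiv e (by simp)]
  exact hd (e v) t

/-- Vertices of equal profile are interchangeable, so a profile-preserving bijection transports the
colouring. -/
lemma realizable_iff {V : Type*} [Fintype V] {τ : V → Profile ℓ B} {N : Profile ℓ B → ℕ}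
    (h : ∀ p, #{v | τ v = p} = N p) : Realizable τ ↔ RealizableSize N := by
  let e : V ≃ Σ p, Fin (N p) := (Equiv.sigmaFiberEquiv τ).symm.trans
    (Equiv.sigmaCongrRight fun p => Fintype.equivFinOfCardEq (by
      rw [Fintype.card_subtype]; exact h p))
  have he : ∀ v, (e v).1 = τ v := fun v => rfl
  constructor
  · intro hr
    have : (fun v : Σ p, Fin (N p) => v.1) = τ ∘ e.symm := by
      ext v : 1
      rw [Function.comp_apply, ← he, Equiv.apply_symm_apply]
    rw [RealizableSize, this]
    exact hr.comp_equiv e.symm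
  · exact fun hr => hr.comp_equiv e

/-- The sets of profiles that have to be treated separately when they have few vertices. -/
abbrev Zone (ℓ : ℕ) := (HalfEdge ℓ → Bool) ⊕ HalfEdge ℓ

/-- The profiles with a given set of lower bounds, and those with a given positive exact degree. -/
def Zone.Mem : Zone ℓ → Profile ℓ B → Prop
  | .inl U, p => ∀ t, (p t).1 = U t
  | .inr t, p => (p t).1 = false ∧ (p t).2 ≠ 0

instance (x : Zone ℓ) (p : Profile ℓ B) : Decidable (x.Mem p) := by
  cases x <;> unfold Zone.Mem <;> infer_instance

/-- Above this number of vertices a zone counts as big. -/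
def zoneBound (ℓ B : ℕ) : ℕ :=
  (Fintype.card (HalfEdge ℓ) * B + 1) ^ 2 +
    (Fintype.card (HalfEdge ℓ) + 1) * (4 * (Fintype.card (HalfEdge ℓ) * B) + B + 2)

lemma lt_zoneBound (ℓ B : ℕ) : 4 * (Fintype.card (HalfEdge ℓ) * B) + 1 < zoneBound ℓ B := by
  have := Nat.le_mul_of_pos_left (4 * (Fintype.card (HalfEdge ℓ) * B) + B + 2)
    (by omega : 0 < Fintype.card (HalfEdge ℓ) + 1)
  unfold zoneBound
  omega

/-- Between two big zones some edge is of a kind occurring more than `B` times at both ends, so both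
ends carry lower bounds for it; this and double counting give necessity. Conversely, bigness leaves
room for all switches. -/
theorem realizable_iff_of_zones {V : Type*} [Fintype V] (τ : V → Profile ℓ B)
    (hzone : ∀ x : Zone ℓ, #{v | x.Mem (τ v)} = 0 ∨ zoneBound ℓ B < #{v | x.Mem (τ v)}) :
    Realizable τ ↔
      (∀ U W : HalfEdge ℓ → Bool, (∀ t, ¬ (U t = true ∧ W t.bar = true)) →
        #{v | Zone.Mem (.inl U) (τ v)} = 0 ∨ #{v | Zone.Mem (.inl W) (τ v)} = 0) ∧
      ∀ t : HalfEdge ℓ, #{v | (τ v t.bar).1 = true} = 0 →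
        ∑ v, ((τ v t).2 : ℕ) ≤ ∑ v, ((τ v t.bar).2 : ℕ) := by
  classical
  have hK := lt_zoneBound ℓ B
  have hB : ∀ v t, ((τ v t).2 : ℕ) ≤ B := fun v t => Nat.lt_succ_iff.1 (τ v t).2.2
  constructor
  · rintro ⟨P, hP, hd⟩
    refine ⟨fun U W hUW => ?_, fun t ht => ?_⟩
    · by_contra! h
      have hU := (hzone (.inl U)).resolve_left h.1
      have hW := (hzone (.inl W)).resolve_left h.2
      obtain ⟨x, hx, y, hy, hxy, hlt⟩ := P.exists_forall_lt_deg (B := B) _ _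
        ((by omega : 2 * (Fintype.card (HalfEdge ℓ) * B) < _).trans hU) (hK.trans hW)
      obtain ⟨t, ht⟩ := Option.ne_none_iff_exists'.1 (hP x y hxy)
      have hlo : ∀ v s, B < P.deg v s → (τ v s).1 = true := fun v s h => by
        by_contra h'
        have := (hd v s).2 (by simpa using h')
        have := hB v s
        omega
      exact hUW t ⟨((mem_filter.1 hx).2 t).symm.trans (hlo x t (hlt t ht).1),
        ((mem_filter.1 hy).2 t.bar).symm.trans (hlo y _ (hlt t ht).2)⟩
    · rw [card_eq_zero, filter_eq_empty_iff] at ht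
      calc ∑ v, ((τ v t).2 : ℕ) ≤ ∑ v, P.deg v t := sum_le_sum fun v _ => (hd v t).1
        _ = ∑ v, P.deg v t.bar := (P.sum_deg_bar t).symm
        _ ≤ _ := sum_le_sum fun v _ => (hd v t.bar).2 (by simpa using ht (mem_univ v))
  · rintro ⟨hcompat, hsum⟩
    have hbig : ∀ v, zoneBound ℓ B < #{w | Zone.Mem (.inl fun t => (τ v t).1) (τ w)} := fun v =>
      (hzone _).resolve_left (card_ne_zero_of_mem (a := v) (by simp [Zone.Mem]))
    have hstrict : ∀ t : HalfEdge ℓ, (∀ v, ¬ (τ v t.bar).1 = true) → #{v | (τ v t.bar).1 = true} = 0 :=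
      fun t ht => by simpa using ht
    -- The three constructions are applied from the inside out; the two summands of `zoneBound` are
    -- the sizes required by `exists_deg_le` and `exists_le_deg`.
    obtain ⟨P, hP, hd⟩ := PartialColoring.exists_complete (V := V)
      (lo := fun v t => (τ v t).1 = true) (d := fun v t => (τ v t).2) (fun u v _ => by
        by_contra! h
        rcases hcompat (fun t => (τ u t).1) (fun t => (τ v t).1) (fun t ht => h t ht.1 ht.2) with
          h | h
        · exact absurd (hbig u) (by omega)
        · exact absurd (hbig v) (by omega)) <|
      PartialColoring.exists_le_deg (K := zoneBound ℓ B) hB (Nat.le_add_left _ _)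
        (fun t ⟨v, hv⟩ => ⟨_, fun w hw => by
          have := (mem_filter.1 hw).2 t
          exact this.trans hv, hbig v⟩) <| by
      obtain ⟨P, hP, hP'⟩ := PartialColoring.exists_deg_le (V := V)
        (d := fun v t => (τ v t).2) (K := zoneBound ℓ B) hB (Nat.le_add_right _ _)
        (fun t => ∀ v, ¬ (τ v t.bar).1 = true) (fun t ht => by
          refine (hzone (.inr t.bar)).imp (fun h v => ?_) fun h => h.trans_le (card_le_card ?_)
          · rw [card_eq_zero, filter_eq_empty_iff] at h
            by_contra hv
            exact h (mem_univ v) ⟨by simpa using ht v, fun h => hv (by simp [h])⟩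
          · exact fun v h => mem_filter.2 ⟨mem_univ _, fun h' =>
              (mem_filter.1 h).2.2 (Fin.ext h')⟩) fun t ht => hsum t (hstrict t ht)
      exact ⟨P, fun v t _ => hP v t, fun t ht v => (hP' t ht v).ge⟩
    exact ⟨P, hP, fun v t => ⟨hd.2 v t, fun h => hd.1 v t (by simp [h])⟩⟩

/-! ### Multiplicity vectors and additive counting maps -/

/-- The additive map `N ↦ ∑ i, N i * w i`. -/
def weightedSum {ι : Type*} [Fintype ι] (w : ι → ℕ) : (ι → ℕ) →+ ℕ where
  toFun N := ∑ i, N i * w i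
  map_zero' := by simp
  map_add' N M := by simp [add_mul, sum_add_distrib]

lemma weightedSum_apply {ι : Type*} [Fintype ι] (w N : ι → ℕ) :
    weightedSum w N = ∑ i, N i * w i := rfl

/-- The number of elements with property `q` in a multiset with multiplicities `N`. -/
def count {ι : Type*} [Fintype ι] (q : ι → Prop) [DecidablePred q] : (ι → ℕ) →+ ℕ :=
  weightedSum fun i => if q i then 1 else 0

lemma sum_sigma_fst {ι : Type*} [Fintype ι] (N w : ι → ℕ) :
    ∑ v : Σ i, Fin (N i), w v.1 = weightedSum w N := by
  simp [Fintype.sum_sigma, weightedSum_apply]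

lemma card_sigma_fst {ι : Type*} [Fintype ι] (N : ι → ℕ) (q : ι → Prop) [DecidablePred q] :
    #{v : Σ i, Fin (N i) | q v.1} = count q N := by
  rw [card_filter]
  exact sum_sigma_fst N fun i => if q i then 1 else 0

theorem realizableSize_iff_of_zones (N : Profile ℓ B → ℕ)
    (hzone : ∀ x : Zone ℓ, count x.Mem N = 0 ∨ zoneBound ℓ B < count x.Mem N) :
    RealizableSize N ↔
      (∀ U W : HalfEdge ℓ → Bool, (∀ t, ¬ (U t = true ∧ W t.bar = true)) →
        count (Zone.Mem (.inl U)) N = 0 ∨ count (Zone.Mem (.inl W)) N = 0) ∧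
      ∀ t : HalfEdge ℓ, count (fun p : Profile ℓ B => (p t.bar).1 = true) N = 0 →
        weightedSum (fun p => ((p t).2 : ℕ)) N ≤ weightedSum (fun p => ((p t.bar).2 : ℕ)) N := by
  simp only [← card_sigma_fst, ← sum_sigma_fst] at hzone ⊢
  exact realizable_iff_of_zones _ hzone

section Count

variable {ι κ : Type*} [Fintype ι]

lemma count_apply (q : ι → Prop) [DecidablePred q] (N : ι → ℕ) :
    count q N = ∑ i, if q i then N i else 0 := by
  simp [count, weightedSum_apply]

lemma count_eq_zero {q : ι → Prop} [DecidablePred q] {N : ι → ℕ} :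
    count q N = 0 ↔ ∀ i, q i → N i = 0 := by
  simp [count_apply]

lemma count_mono {q r : ι → Prop} [DecidablePred q] [DecidablePred r] (N : ι → ℕ)
    (h : ∀ i, q i → r i) : count q N ≤ count r N := by
  rw [count_apply, count_apply]
  refine sum_le_sum fun i _ => ?_
  by_cases hq : q i
  · simp [hq, h i hq]
  · simp [hq]

/-- The image of a multiset with multiplicities `N` under `f`. -/
def fiberCount [DecidableEq κ] (f : ι → κ) : (ι → ℕ) →+ (κ → ℕ) where
  toFun N k := count (fun i => f i = k) N
  map_zero' := by ext k; simp
  map_add' N M := by ext k; simp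

lemma fiberCount_apply [DecidableEq κ] (f : ι → κ) (N : ι → ℕ) (k : κ) :
    fiberCount f N k = count (fun i => f i = k) N := rfl

lemma count_fiberCount [Fintype κ] [DecidableEq κ] (f : ι → κ) (q : κ → Prop) [DecidablePred q]
    (N : ι → ℕ) : count q (fiberCount f N) = count (fun i => q (f i)) N := by
  simp only [count_apply, fiberCount_apply, ← sum_filter]
  rw [sum_filter, sum_filter, ← sum_fiberwise (f := fun i => if q (f i) then N i else 0) univ f]
  refine sum_congr rfl fun k _ => ?_
  split_ifs with h
  · exact sum_congr rfl fun i hi => by rw [(mem_filter.1 hi).2, if_pos h]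
  · exact (sum_eq_zero fun i hi => by rw [(mem_filter.1 hi).2, if_neg h]).symm

lemma count_single [DecidableEq ι] (q : ι → Prop) [DecidablePred q] (i : ι) :
    count q (Pi.single i 1) = if q i then 1 else 0 := by
  rw [count_apply, sum_eq_single i (fun j _ hj => by simp [hj]) (by simp), Pi.single_eq_same]

lemma card_filter_elim [DecidableEq κ] (k : κ) (f : ι → κ) (l : κ) :
    #{i : Option ι | i.elim k f = l} = (Pi.single k 1 : κ → ℕ) l + #{i | f i = l} := by
  rw [card_filter, card_filter, Fintype.sum_option, Pi.single_apply]
  simp only [Option.elim_none, Option.elim_some, eq_comm (a := l)]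
  congr

end Count

/-! ### Deleting one vertex -/

/-- A vertex of profile `p` can be given an edge that looks like `t`. -/
def Admits (p : Profile ℓ B) (t : HalfEdge ℓ) : Prop := (p t).1 = true ∨ ((p t).2 : ℕ) ≠ 0

instance (p : Profile ℓ B) (t : HalfEdge ℓ) : Decidable (Admits p t) := by
  unfold Admits; infer_instance

/-- What remains to be satisfied when a vertex of profile `p` has got an edge that looks like
`t`. -/
def residualProfile (p : Profile ℓ B) (t : HalfEdge ℓ) : Profile ℓ B := fun s =>
  ((p s).1, ⟨(p s).2 - if s = t then 1 else 0, by omega⟩)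

/-- Truncated subtraction does no harm in `residualProfile`: a lower bound 0 rightly stays 0, and an
exact degree 0 is excluded by `Admits`. -/
lemma forall_meets_iff (p : Profile ℓ B) (t : HalfEdge ℓ) (k : HalfEdge ℓ → ℕ) :
    (∀ s, Meets (p s) (k s + if s = t then 1 else 0)) ↔
      Admits p t ∧ ∀ s, Meets (residualProfile p t s) (k s) := by
  have key : ∀ s, Meets (residualProfile p t s) (k s) ∧ (s = t → Admits p t) ↔
      Meets (p s) (k s + if s = t then 1 else 0) := fun s => by
    by_cases hs : s = t
    · subst hs
      simp only [Meets, residualProfile, Admits, if_true, forall_const, ne_eq]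
      generalize ((p s).2 : ℕ) = d
      cases (p s).1
      · simp
        omega
      · simp
    · simp [hs, Meets, residualProfile]
  simp only [← key]
  exact ⟨fun h => ⟨(h t).2 rfl, fun s => (h s).1⟩, fun h s => ⟨h.2 s, fun _ => h.1⟩⟩

lemma Zone.Mem.of_residual {x : Zone ℓ} {p : Profile ℓ B} {t : HalfEdge ℓ}
    (h : x.Mem (residualProfile p t)) : x.Mem p := by
  cases x with
  | inl U => exact h
  | inr s =>
    refine ⟨h.1, fun h0 => h.2 ?_⟩
    simp [residualProfile, h0]

theorem realizable_option_iff {V : Type*} [Fintype V] (τ : Option V → Profile ℓ B) :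
    Realizable τ ↔ ∃ c : V → HalfEdge ℓ, (∀ v, Admits (τ (some v)) (c v)) ∧
      (∀ t, Meets (τ none t) #{v | (c v).bar = t}) ∧
      Realizable fun v => residualProfile (τ (some v)) (c v) := by
  classical
  constructor
  · rintro ⟨P, hP, hd⟩
    choose c hc using fun v : V =>
      Option.ne_none_iff_exists'.1 (hP (some v) none (Option.some_ne_none v))
    let Q : PartialColoring ℓ V :=
      ⟨fun u v => P.col (some u) (some v), fun _ => P.col_self _, fun _ _ => P.col_symm _ _⟩
    have h : ∀ v, Admits (τ (some v)) (c v) ∧ ∀ t, Meets (residualProfile (τ (some v)) (c v) t)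
        (Q.deg v t) := fun v => by
      rw [← forall_meets_iff]
      intro s
      convert hd (some v) s using 1
      simp only [PartialColoring.deg, card_filter, Fintype.sum_option, hc, Q, Option.some_inj,
        eq_comm (a := s)]
      omega
    refine ⟨c, fun v => (h v).1, fun t => ?_, Q, fun u v huv => hP _ _ (by simpa), fun v => (h v).2⟩
    convert hd none t using 1
    simp only [PartialColoring.deg, card_filter, Fintype.sum_option, P.col_self]
    simp [fun v => P.col_eq_some_comm.1 (hc v)]
  · rintro ⟨c, hadm, hnone, Q, hQ, hd⟩
    let col : Option V → Option V → Option (HalfEdge ℓ)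
      | some u, some v => Q.col u v
      | some u, none => some (c u)
      | none, some v => some (c v).bar
      | none, none => none
    refine ⟨⟨col, fun v => ?_, fun u v => ?_⟩, fun u v huv => ?_, fun v => ?_⟩
    · cases v <;> simp [col, Q.col_self]
    · cases u <;> cases v <;> simp [col]
      exact Q.col_symm _ _
    · cases u <;> cases v <;> simp_all [col]
    · cases v with
      | none =>
        intro t
        convert hnone t using 1
        simp only [PartialColoring.deg, card_filter, Fintype.sum_option, col]
        simp
      | some v =>
        intro s
        convert (forall_meets_iff _ _ _).2 ⟨hadm v, hd v⟩ s using 1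
        simp only [PartialColoring.deg, card_filter, Fintype.sum_option, col, Option.some_inj,
          eq_comm (a := s)]
        omega

/-- `M` counts the remaining vertices by profile and by their edge to the deleted vertex. Identities
of vertices disappear, and everything but the residual realizability is a condition on sums of
entries of `M`. -/
theorem realizableSize_single_add_iff (N : Profile ℓ B → ℕ) (p : Profile ℓ B) :
    RealizableSize (Pi.single p 1 + N) ↔ ∃ M : Profile ℓ B × HalfEdge ℓ → ℕ,
      (count (fun x => ¬ Admits x.1 x.2) M = 0 ∧
        (∀ t, Meets (p t) (count (fun x => x.2.bar = t) M)) ∧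
        RealizableSize (fiberCount (fun x => residualProfile x.1 x.2) M)) ∧
      fiberCount Prod.fst M = N := by
  constructor
  · intro h
    let τ : Option (Σ q, Fin (N q)) → Profile ℓ B := fun v => v.elim p Sigma.fst
    rw [← realizable_iff (τ := τ), realizable_option_iff] at h
    · obtain ⟨c, hadm, hnone, hr⟩ := h
      let M : Profile ℓ B × HalfEdge ℓ → ℕ := fun x => #{v | (v.1, c v) = x}
      have hM : ∀ (q : Profile ℓ B × HalfEdge ℓ → Prop) [DecidablePred q],
          count q M = #{v | q (v.1, c v)} := fun q _ => by
        rw [count_apply, card_eq_sum_card_fiberwise (f := fun v => (v.1, c v)) (t := univ)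
          (by simp)]
        refine sum_congr rfl fun x _ => ?_
        rw [filter_filter]
        split_ifs with hx
        · exact congrArg card (filter_congr fun v _ => ⟨fun h => ⟨h ▸ hx, h⟩, fun h => h.2⟩)
        · rw [filter_false_of_mem, card_empty]
          exact fun v _ h => hx (h.2 ▸ h.1)
      refine ⟨M, ⟨?_, fun t => ?_, ?_⟩, ?_⟩
      · rw [hM]
        rw [card_eq_zero, filter_eq_empty_iff]
        exact fun v _ h => h (hadm v)
      · rw [hM]
        exact hnone t
      · rw [← realizable_iff (τ := fun v => residualProfile (τ (some v)) (c v))]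
        · exact hr
        · intro q
          rw [fiberCount_apply, hM]
          rfl
      · ext q
        rw [fiberCount_apply, hM, card_sigma_fst N (· = q), count_apply]
        simp
    · intro q
      rw [card_filter_elim, card_sigma_fst N (· = q), count_apply]
      simp
  · rintro ⟨M, ⟨hadm, hnone, hr⟩, rfl⟩
    let τ : Option (Σ x, Fin (M x)) → Profile ℓ B := fun v => v.elim p fun v => v.1.1
    rw [← realizable_iff (τ := τ), realizable_option_iff]
    · refine ⟨fun v => v.1.2, fun v => ?_, fun t => ?_, ?_⟩
      · by_contra h
        have := count_eq_zero.1 hadm v.1 h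
        exact absurd v.2.2 (by omega)
      · rw [card_sigma_fst M fun x => x.2.bar = t]
        exact hnone t
      · rw [realizable_iff]
        · exact hr
        · exact fun q => card_sigma_fst M fun x => residualProfile x.1 x.2 = q
    · intro q
      rw [card_filter_elim, card_sigma_fst M (·.1 = q)]
      rfl

/-! ### Closure properties of semilinear sets -/

namespace IsSemilinearSet

variable {M : Type*} [AddCommMonoid M] {p q : M → Prop}

lemma and (hp : IsSemilinearSet {x | p x}) (hq : IsSemilinearSet {x | q x}) :
    IsSemilinearSet {x | p x ∧ q x} :=
  hp.inter hq

lemma or (hp : IsSemilinearSet {x | p x}) (hq : IsSemilinearSet {x | q x}) :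
    IsSemilinearSet {x | p x ∨ q x} :=
  hp.union hq

lemma ex {ι : Type*} [Finite ι] {p : ι → M → Prop} (hp : ∀ i, IsSemilinearSet {x | p i x}) :
    IsSemilinearSet {x | ∃ i, p i x} := by
  rw [Set.ofPred_exists]
  exact iUnion hp

variable [AddMonoid.FG M]

lemma imp (hp : IsSemilinearSet {x | p x}) (hq : IsSemilinearSet {x | q x}) :
    IsSemilinearSet {x | p x → q x} := by
  simp only [imp_iff_not_or]
  exact hp.compl.or hq

lemma all {ι : Type*} [Finite ι] {p : ι → M → Prop} (hp : ∀ i, IsSemilinearSet {x | p i x}) :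
    IsSemilinearSet {x | ∀ i, p i x} := by
  rw [Set.ofPred_forall]
  exact iInter hp

lemma const (P : Prop) : IsSemilinearSet {_x : M | P} := by
  by_cases h : P
  · simp [h]
  · simp [h]

lemma eq_nat (f : M →+ ℕ) (n : ℕ) : IsSemilinearSet {x | f x = n} :=
  (singleton n).preimage f

lemma le_nat (f : M →+ ℕ) (n : ℕ) : IsSemilinearSet {x | f x ≤ n} :=
  (of_finite (Set.finite_Iic n)).preimage f

lemma nat_le (f : M →+ ℕ) (n : ℕ) : IsSemilinearSet {x | n ≤ f x} := by
  convert! (of_finite (Set.finite_Iio n)).compl.preimage f using 1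
  ext x; simp

/-- The order on `ℕ` is the image of `ℕ × ℕ` under `(a, b) ↦ (a, a + b)`; pull it back along `(f,
g)`. -/
lemma le_of_addMonoidHom (f g : M →+ ℕ) : IsSemilinearSet {x | f x ≤ g x} := by
  have h := (IsSemilinearSet.univ (M := ℕ × ℕ)).image
    ((AddMonoidHom.fst ℕ ℕ).prod (AddMonoidHom.fst ℕ ℕ + AddMonoidHom.snd ℕ ℕ))
  convert! h.preimage (f.prod g) using 1
  ext x
  simp only [Set.image_univ, Set.mem_preimage, Set.mem_range, Set.mem_ofPred_eq]
  refine ⟨fun hx => ⟨(f x, g x - f x), by simp [hx]⟩, fun ⟨⟨a, b⟩, hab⟩ => ?_⟩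
  simp only [AddMonoidHom.prod_apply, Prod.mk.injEq] at hab
  simp at hab
  omega

end IsSemilinearSet

/-! ### Semilinearity by induction on small zones -/

open IsSemilinearSet

lemma isSemilinearSet_meets {M : Type*} [AddCommMonoid M] [AddMonoid.FG M]
    (p : Bool × Fin (B + 1)) (f : M →+ ℕ) : IsSemilinearSet {x | Meets p (f x)} :=
  (nat_le f _).and ((const _).imp (le_nat f _))

/-- The zones outside `Z` are big. -/
lemma isSemilinearSet_of_zones_big (Z : Finset (Zone ℓ)) :
    IsSemilinearSet {N : Profile ℓ B → ℕ | (RealizableSize N ∧ ∀ x ∈ Z, count x.Mem N = 0) ∧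
      ∀ x : Zone ℓ, count x.Mem N = 0 ∨ zoneBound ℓ B < count x.Mem N} := by
  have h : ∀ N : Profile ℓ B → ℕ, ((RealizableSize N ∧ ∀ x ∈ Z, count x.Mem N = 0) ∧
      ∀ x : Zone ℓ, count x.Mem N = 0 ∨ zoneBound ℓ B < count x.Mem N) ↔ _ := fun N =>
    and_assoc.trans (and_congr_left fun h => realizableSize_iff_of_zones N h.2)
  simp only [h]
  refine .and (.and (.all fun U => .all fun W => .imp (.const _) (.or (eq_nat _ _)
    (eq_nat _ _))) (.all fun t => .imp (eq_nat _ _) (le_of_addMonoidHom _ _)))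
    (.and (.all fun x => .imp (.const _) (eq_nat _ _))
      (.all fun x => .or (eq_nat _ _) (nat_le _ _)))

/-- Deleting a vertex of zone `x` lowers its count, and residual profiles enter no new zone, so the
case `k` applies to what remains and the zones in `Z` stay empty. -/
lemma isSemilinearSet_of_count_le (Z : Finset (Zone ℓ)) (x : Zone ℓ)
    (h : IsSemilinearSet {N : Profile ℓ B → ℕ |
      (RealizableSize N ∧ ∀ y ∈ Z, count y.Mem N = 0) ∧ count x.Mem N ≤ 0}) (k : ℕ) :
    IsSemilinearSet {N : Profile ℓ B → ℕ |
      (RealizableSize N ∧ ∀ y ∈ Z, count y.Mem N = 0) ∧ count x.Mem N ≤ k} := by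
  induction k with
  | zero => exact h
  | succ k ih =>
    let S (p : Profile ℓ B) : Set (Profile ℓ B × HalfEdge ℓ → ℕ) :=
      {M | (count (fun x => ¬ Admits x.1 x.2) M = 0 ∧
        ∀ t, Meets (p t) (count (fun x => x.2.bar = t) M)) ∧
        (RealizableSize (fiberCount (fun x => residualProfile x.1 x.2) M) ∧
          ∀ y ∈ Z, count y.Mem (fiberCount (fun x => residualProfile x.1 x.2) M) = 0) ∧
        count x.Mem (fiberCount (fun x => residualProfile x.1 x.2) M) ≤ k}
    have hS : ∀ p, IsSemilinearSet (S p) := fun p =>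
      ((eq_nat _ _).and (.all fun t => isSemilinearSet_meets _ _)).and (ih.preimage _)
    have hcount : ∀ (y : Zone ℓ) (M : Profile ℓ B × HalfEdge ℓ → ℕ),
        count y.Mem (fiberCount (fun x => residualProfile x.1 x.2) M) ≤
          count y.Mem (fiberCount Prod.fst M) := fun y M => by
      rw [count_fiberCount, count_fiberCount]
      exact count_mono _ fun _ => Zone.Mem.of_residual
    -- The guess `M` is eliminated by an image, and the deleted vertex is put back by a translation.
    -- Its profile need not be restricted to `x` here, because the count bound is imposed
    -- separately.
    convert! h.or (.and (.and (.all fun y : Zone ℓ => .imp (.const (y ∈ Z))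
      (eq_nat (count y.Mem) 0)) (le_nat (count x.Mem) (k + 1))) (.ex fun p : Profile ℓ B =>
        ((hS p).image (fiberCount Prod.fst)).vadd (Pi.single p 1))) using 1
    ext N
    simp only [Set.mem_ofPred_eq]
    constructor
    · rintro ⟨⟨hN, hZ⟩, hx⟩
      rcases Nat.eq_zero_or_pos (count x.Mem N) with h0 | h0
      · exact Or.inl ⟨⟨hN, hZ⟩, h0.le⟩
      · right
        refine ⟨⟨hZ, hx⟩, ?_⟩
        have : ∃ p, x.Mem p ∧ N p ≠ 0 := by
          by_contra! hcon
          exact h0.ne' (count_eq_zero.2 hcon)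
        obtain ⟨p, hp, hNp⟩ := this
        obtain ⟨N', rfl⟩ : ∃ N', N = Pi.single p 1 + N' := ⟨N - Pi.single p 1, by
          ext q
          by_cases hq : q = p
          · subst hq
            simp; omega
          · simp [hq]⟩
        obtain ⟨M, ⟨h1, h2, h3⟩, rfl⟩ := (realizableSize_single_add_iff N' p).1 hN
        refine ⟨p, Set.vadd_mem_vadd_set ⟨M, ⟨⟨h1, h2⟩, ⟨h3, fun y hy => ?_⟩, ?_⟩, rfl⟩⟩
        · have := hZ y hy
          rw [map_add] at this
          have := hcount y M
          omega
        · rw [map_add, count_single, if_pos hp] at hx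
          have := hcount x M
          omega
    · rintro (⟨h1, h2⟩ | ⟨⟨h1, h2⟩, p, hp⟩)
      · exact ⟨h1, h2.trans (Nat.zero_le _)⟩
      · obtain ⟨_, ⟨M, ⟨⟨h3, h4⟩, ⟨h5, -⟩, -⟩, rfl⟩, rfl⟩ := hp
        exact ⟨⟨(realizableSize_single_add_iff _ p).2 ⟨M, ⟨h3, h4, h5⟩, rfl⟩, h1⟩, h2⟩

/-- Either all zones are empty or big, or some zone outside `Z` is small; the latter case reduces to
adding that zone to `Z`. -/
lemma isSemilinearSet_of_zones_empty (Z : Finset (Zone ℓ)) :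
    IsSemilinearSet {N : Profile ℓ B → ℕ | RealizableSize N ∧ ∀ x ∈ Z, count x.Mem N = 0} := by
  induction hn : #Zᶜ using Nat.strong_induction_on generalizing Z with
  | _ n ih =>
    have hstep : ∀ x : Zone ℓ, x ∉ Z → IsSemilinearSet {N : Profile ℓ B → ℕ |
        (RealizableSize N ∧ ∀ y ∈ Z, count y.Mem N = 0) ∧ count x.Mem N ≤ zoneBound ℓ B} := by
      intro x hx
      refine isSemilinearSet_of_count_le Z x ?_ _
      convert ih #(insert x Z)ᶜ ?_ _ rfl using 3 with N
      · simp only [Nat.le_zero, forall_mem_insert]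
        tauto
      · rw [← hn]
        exact card_lt_card (compl_ssubset_compl.2 (ssubset_insert hx))
    convert! (isSemilinearSet_of_zones_big Z).or (.ex fun x : {x : Zone ℓ // x ∉ Z} => hstep x x.2)
      using 1
    ext N
    simp only [Set.mem_ofPred_eq, Subtype.exists]
    constructor
    · rintro ⟨hN, hZ⟩
      by_cases hbig : ∀ x : Zone ℓ, count x.Mem N = 0 ∨ zoneBound ℓ B < count x.Mem N
      · exact Or.inl ⟨⟨hN, hZ⟩, hbig⟩
      · push Not at hbig
        obtain ⟨x, hx, hle⟩ := hbig
        exact Or.inr ⟨x, fun h => hx (hZ x h), ⟨hN, hZ⟩, hle⟩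
    · rintro (h | ⟨_, _, h, _⟩)
      exacts [h.1, h]

theorem isSemilinearSet_realizableSize :
    IsSemilinearSet {N : Profile ℓ B → ℕ | RealizableSize N} := by
  simpa using isSemilinearSet_of_zones_empty (B := B) (∅ : Finset (Zone ℓ))

/-! ### Translation between digraphs and colourings -/

/-- The bound in a degree specification. -/
def DegreeSpec.bound : DegreeSpec → ℕ
  | .exactly d => d
  | .atLeast d => d

/-- A degree specification with bound at most `B` as a flag and a bound. -/
def DegreeSpec.toProd (B : ℕ) (s : DegreeSpec) : Bool × Fin (B + 1) :=
  (match s with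
    | .exactly _ => false
    | .atLeast _ => true, ⟨min s.bound B, by omega⟩)

lemma DegreeSpec.meets_toProd {s : DegreeSpec} (h : s.bound ≤ B) (k : ℕ) :
    Meets (s.toProd B) k ↔ s.Holds k := by
  cases s with
  | exactly d =>
    simp only [Meets, toProd, min_eq_left h, forall_const]
    exact ⟨fun h => h.2.antisymm h.1, fun h => ⟨h.ge, h.le⟩⟩
  | atLeast d =>
    simp only [Meets, toProd, min_eq_left h, reduceCtorEq, false_implies, and_true]
    rfl

/-- The profile of the vertices in the part `j`. -/
def profileOfPart {m : ℕ} (B : ℕ) (C D : Matrix (Fin ℓ) (Fin m) DegreeSpec) (j : Fin m) :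
    Profile ℓ B := fun t =>
  (if t.2 = true then D t.1 j else C t.1 j).toProd B

lemma forall_meets_profileOfPart_iff {m : ℕ} {C D : Matrix (Fin ℓ) (Fin m) DegreeSpec}
    (hC : ∀ i j, (C i j).bound ≤ B) (hD : ∀ i j, (D i j).bound ≤ B) (j : Fin m)
    (k : HalfEdge ℓ → ℕ) :
    (∀ t, Meets (profileOfPart B C D j t) (k t)) ↔
      (∀ i, (C i j).Holds (k (i, false))) ∧ ∀ i, (D i j).Holds (k (i, true)) := by
  simp only [← DegreeSpec.meets_toProd (hC _ _), ← DegreeSpec.meets_toProd (hD _ _)]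
  refine ⟨fun h => ⟨fun i => h (i, false), fun i => h (i, true)⟩, fun h => ?_⟩
  rintro ⟨i, _ | _⟩
  exacts [h.1 i, h.2 i]

namespace TypeDigraph

variable {V : Type*} (G : TypeDigraph ℓ V)

/-- There is an edge between `u` and `v` that looks like `t` from `u`. -/
def Joined (t : HalfEdge ℓ) (u v : V) : Prop := if t.2 = true then G.E t.1 u v else G.E t.1 v u

lemma Joined.unique {s t : HalfEdge ℓ} {u v : V} (hs : G.Joined s u v) (ht : G.Joined t u v) :
    s = t := by
  obtain ⟨i, b⟩ := s
  obtain ⟨j, c⟩ := t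
  have h : ∀ u v, G.E i u v → G.E j u v → i = j := fun u v h h' =>
    by_contra fun hij => G.pairwise_disjoint i j hij u v ⟨h, h'⟩
  cases b <;> cases c <;> simp only [Joined, if_true, Bool.false_eq_true, if_false] at hs ht
  · rw [h _ _ hs ht]
  · exact (G.no_inverse _ _ ⟨i, hs⟩ ⟨j, ht⟩).elim
  · exact (G.no_inverse _ _ ⟨i, hs⟩ ⟨j, ht⟩).elim
  · rw [h _ _ hs ht]

lemma joined_bar {t : HalfEdge ℓ} {u v : V} : G.Joined t.bar v u ↔ G.Joined t u v := by
  obtain ⟨i, b⟩ := t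
  cases b <;> simp [Joined, bar]

open Classical in
/-- The partial colouring given by a digraph. -/
noncomputable def toPartialColoring : PartialColoring ℓ V where
  col u v := if h : ∃ t, G.Joined t u v then some h.choose else none
  col_self v := dif_neg fun ⟨t, ht⟩ => by
    unfold Joined at ht
    split_ifs at ht <;> exact G.irreflexive _ _ ht
  col_symm u v := by
    by_cases h : ∃ t, G.Joined t u v
    · have h' : ∃ t, G.Joined t v u := ⟨_, G.joined_bar.2 h.choose_spec⟩
      rw [dif_pos h, dif_pos h']
      exact congrArg some (Joined.unique G h'.choose_spec (G.joined_bar.2 h.choose_spec))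
    · have h' : ¬ ∃ t, G.Joined t v u := fun ⟨t, ht⟩ => h ⟨_, G.joined_bar.2 ht⟩
      rw [dif_neg h, dif_neg h']
      rfl

lemma toPartialColoring_col_eq_some {t : HalfEdge ℓ} {u v : V} :
    G.toPartialColoring.col u v = some t ↔ G.Joined t u v := by
  classical
  unfold toPartialColoring
  constructor
  · intro h
    simp only at h
    split_ifs at h with h'
    exact Option.some_inj.1 h ▸ h'.choose_spec
  · intro h
    have h' : ∃ t, G.Joined t u v := ⟨t, h⟩
    simp only [dif_pos h', Option.some_inj]
    exact Joined.unique G h'.choose_spec h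

lemma deg_toPartialColoring [Fintype V] (v : V) (i : Fin ℓ) :
    G.toPartialColoring.deg v (i, false) = G.inDeg i v ∧
      G.toPartialColoring.deg v (i, true) = G.outDeg i v := by
  classical
  simp only [PartialColoring.deg, toPartialColoring_col_eq_some]
  constructor <;>
  · simp only [inDeg, outDeg, Set.ncard_eq_toFinset_card', Set.toFinset_ofPred]
    congr

end TypeDigraph

/-- The digraph given by a partial colouring. -/
def PartialColoring.toTypeDigraph {V : Type*} (P : PartialColoring ℓ V) : TypeDigraph ℓ V where
  E i u v := P.col u v = some (i, true)
  pairwise_disjoint i j hij u v h := hij (by simpa using h.1.symm.trans h.2)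
  irreflexive i v h := P.ne_of_col_eq_some h rfl
  no_inverse := by
    rintro u v ⟨i, hi⟩ ⟨j, hj⟩
    have := hi.symm.trans (P.col_eq_some_comm.1 hj)
    simp [bar] at this

/-- Different parts may have the same profile, so their sizes are merged by `fiberCount`. This map
is additive, so semilinearity can be pulled back along it. -/
theorem existsCompleteRegularDigraph_iff {m : ℕ} {C D : Matrix (Fin ℓ) (Fin m) DegreeSpec}
    (hC : ∀ i j, (C i j).bound ≤ B) (hD : ∀ i j, (D i j).bound ≤ B) (N : Fin m → ℕ) :
    ExistsCompleteRegularDigraph C D N ↔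
      RealizableSize (fiberCount (profileOfPart B C D) N) := by
  classical
  constructor
  · rintro ⟨V, hV, G, hG, P, hP, hN⟩
    have := Fintype.ofFinite V
    choose part hpart using fun v => Set.mem_iUnion.1 (hP.cover.symm ▸ Set.mem_univ v)
    have hmem : ∀ v j, part v = j ↔ v ∈ P j := fun v j => by
      refine ⟨fun h => h ▸ hpart v, fun h => by_contra fun hne => ?_⟩
      exact (Set.disjoint_left.1 (hP.disjoint hne)) (hpart v) h
    rw [← realizable_iff (τ := profileOfPart B C D ∘ part)]
    · refine ⟨G.toPartialColoring, fun u v huv hnone => ?_, fun v => ?_⟩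
      · have h : ∀ t, ¬ G.Joined t u v := fun t ht => by
          simp [G.toPartialColoring_col_eq_some.2 ht] at hnone
        rcases hG u v huv with ⟨i, hi⟩ | ⟨i, hi⟩
        · exact h (i, true) hi
        · exact h (i, false) hi
      · refine (forall_meets_profileOfPart_iff hC hD (part v) _).2 ⟨fun i => ?_, fun i => ?_⟩
        · rw [(G.deg_toPartialColoring v i).1]
          exact hP.inDeg_holds i _ v (hpart v)
        · rw [(G.deg_toPartialColoring v i).2]
          exact hP.outDeg_holds i _ v (hpart v)
    · intro q
      rw [fiberCount_apply, count_apply, card_eq_sum_card_fiberwise (f := part) (t := univ)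
        (by simp)]
      refine sum_congr rfl fun j _ => ?_
      rw [filter_filter]
      split_ifs with hj
      · rw [← hN j, Set.ncard_eq_toFinset_card']
        congr 1
        ext v
        simp only [mem_filter, mem_univ, true_and, Function.comp_apply, Set.mem_toFinset, hmem]
        exact ⟨fun h => h.2, fun h => ⟨by rw [(hmem v j).2 h, hj], h⟩⟩
      · rw [filter_false_of_mem, card_empty]
        rintro v - ⟨h, rfl⟩
        exact hj h
  · intro h
    rw [← realizable_iff (τ := fun v : Σ j, Fin (N j) => profileOfPart B C D v.1)
      (N := fiberCount (profileOfPart B C D) N) fun q => card_sigma_fst N (profileOfPart B C D · = q)] at h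
    obtain ⟨P, hP, hd⟩ := h
    have hd := fun v => (forall_meets_profileOfPart_iff hC hD _ _).1 (hd v)
    have hin : ∀ i v, P.toTypeDigraph.inDeg i v = P.deg v (i, false) := fun i v => by
      simp only [TypeDigraph.inDeg, PartialColoring.toTypeDigraph, Set.ncard_eq_toFinset_card',
        Set.toFinset_ofPred, PartialColoring.deg]
      exact congrArg card (filter_congr fun u _ => P.col_eq_some_comm)
    have hout : ∀ i v, P.toTypeDigraph.outDeg i v = P.deg v (i, true) := fun i v => by
      simp only [TypeDigraph.outDeg, PartialColoring.toTypeDigraph, Set.ncard_eq_toFinset_card',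
        Set.toFinset_ofPred, PartialColoring.deg]
    refine ⟨Σ j, Fin (N j), inferInstance, P.toTypeDigraph, fun u v huv => ?_,
      fun j => {v | v.1 = j}, ⟨fun j k hjk => ?_, ?_, ?_, ?_⟩, fun j => ?_⟩
    · obtain ⟨⟨i, _ | _⟩, ht⟩ := Option.ne_none_iff_exists'.1 (hP u v huv)
      · exact Or.inr ⟨i, P.col_eq_some_comm.1 ht⟩
      · exact Or.inl ⟨i, ht⟩
    · exact Set.disjoint_left.2 fun v hj hk => hjk (hj.symm.trans hk)
    · ext v; simp
    · rintro i _ v rfl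
      rw [hin]
      exact (hd v).1 i
    · rintro i _ v rfl
      rw [hout]
      exact (hd v).2 i
    · rw [Set.ncard_eq_toFinset_card', Set.toFinset_ofPred, card_sigma_fst N (· = j), count_apply]
      simp

theorem mainTheorem8 (ℓ m : ℕ) (C D : Matrix (Fin ℓ) (Fin m) DegreeSpec) :
    ∃ φ : FirstOrder.Language.presburger.Formula (Fin m),
      ∀ N : Fin m → ℕ, ExistsCompleteRegularDigraph C D N ↔ φ.Realize N := by
  obtain ⟨B, hB⟩ : ∃ B, ∀ i j, (C i j).bound ≤ B ∧ (D i j).bound ≤ B := by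
    obtain ⟨B, hB⟩ := (Set.finite_range fun x : Fin ℓ × Fin m =>
      max (C x.1 x.2).bound (D x.1 x.2).bound).bddAbove
    exact ⟨B, fun i j => max_le_iff.1 (hB ⟨(i, j), rfl⟩)⟩
  have h : IsSemilinearSet {N : Fin m → ℕ | ExistsCompleteRegularDigraph C D N} := by
    simp only [existsCompleteRegularDigraph_iff (fun i j => (hB i j).1) fun i j => (hB i j).2]
    exact isSemilinearSet_realizableSize.preimage _
  obtain ⟨φ, hφ⟩ := Set.empty_definable_iff.1
    (FirstOrder.Language.presburger.definable_iff_isSemilinearSet (A := ∅).2 h)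
  exact ⟨φ, fun N => Set.ext_iff.1 hφ N⟩
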